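/- Let $\mathcal H$ be a complex separable infinite-dimensional Hilbert space and let $M>1$. Let $\mathfrak B_M(\mathcal H)$ be the set of all bounded operators $T$ on $\mathcal H$ with $\|T\|\le M$, endowed with the strong$^*$ operator topology $\texttt{SOT}^*$, i.e. the coarsest topology for which all maps $T\mapsto Tx$ and $T\mapsto T^*x$ ($x\in\mathcal H$) into $\mathcal H$ with its norm topology are continuous. For $A\subseteq\mathbb N$ put $\overline{\mathrm{dens}}(A)=\limsup_{n\to\infty}\frac1n\#(A\cap\{1,\dots,n\})$. A vector $x\in\mathcal H$ is distributionally irregular for $T$ if there are sets $A,B\subseteq\mathbb N$ with $\overline{\mathrm{dens}}(A)=\overline{\mathrm{dens}}(B)=1$ such that $\|T^ix\|\to0$ as $i\to\infty$ along $A$ and $\|T^ix\|\to\infty$ as $i\to\infty$ along $B$. The operator $T$ is called distributionally chaotic if it has a distributionally irregular vector, and densely distributionally chaotic if its distributionally irregular vectors are dense in $\mathcal H$. Let $HC(T)$ be the set of vectors $x$ whose orbit $\{T^nx:n\ge0\}$ is dense in $\mathcal H$; $T$ is hypercyclic if $HC(T)\ne\emptyset$, and then $$c(T)=\sup_{x\in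 HC(T)}\overline{\mathrm{dens}}\,\{i\in\mathbb N:\ \|T^ix\|<\alpha\},$$ which does not depend on the choice of $\alpha>0$. Then: 1. the set of densely distributionally chaotic operators in $\mathfrak B_M(\mathcal H)$ is a dense $G_\delta$ subset of $(\mathfrak B_M(\mathcal H),\texttt{SOT}^*)$; 2. the set of distributionally chaotic operators in $\mathfrak B_M(\mathcal H)$ is comeager in $(\mathfrak B_M(\mathcal H),\texttt{SOT}^*)$; 3. the set of hypercyclic operators $T\in\mathfrak B_M(\mathcal H)$ with $c(T)=1$ is comeager in $(\mathfrak B_M(\mathcal H),\texttt{SOT}^*)$, and also comeager in the subspace of all hypercyclic operators in $\mathfrak B_M(\mathcal H)$. -/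

import Mathlib

namespace LinearDynamics

open Filter Topology

noncomputable section

/-- The upper density `limsup_{n → ∞} #(A ∩ {1, …, n}) / n` of a set `A` of natural numbers. -/
def upperDensity (A : Set ℕ) : ℝ :=
  limsup (fun n : ℕ => ((A ∩ Set.Icc 1 n).ncard : ℝ) / (n : ℝ)) atTop

section Operators

variable {H : Type*} [NormedAddCommGroup H] [InnerProductSpace ℂ H]

/-- `x` is a distributionally irregular vector for `T`: there are two sets `A`, `B` of integers, both
of upper density `1`, such that `‖T ^ i x‖ → 0` as `i → ∞` along `A` and `‖T ^ i x‖ → ∞` as `i → ∞`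
along `B`. -/
def IsDistributionallyIrregular (T : H →L[ℂ] H) (x : H) : Prop :=
  ∃ A B : Set ℕ, upperDensity A = 1 ∧ upperDensity B = 1 ∧
    Tendsto (fun i : ℕ => ‖(T ^ i) x‖) (atTop ⊓ 𝓟 A) (𝓝 0) ∧
    Tendsto (fun i : ℕ => ‖(T ^ i) x‖) (atTop ⊓ 𝓟 B) atTop

/-- `T` is distributionally chaotic: it admits a distributionally irregular vector. -/
def IsDistributionallyChaotic (T : H →L[ℂ] H) : Prop :=
  ∃ x : H, IsDistributionallyIrregular T x

/-- `T` is densely distributionally chaotic: it admits a dense set of distributionally irregular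
vectors. -/
def IsDenselyDistributionallyChaotic (T : H →L[ℂ] H) : Prop :=
  Dense {x : H | IsDistributionallyIrregular T x}

/-- The set `HC(T)` of hypercyclic vectors of `T`: the vectors with a dense orbit. -/
def hypercyclicVectors (T : H →L[ℂ] H) : Set H :=
  {x : H | Dense (Set.range fun n : ℕ => (T ^ n) x)}

/-- `T` is hypercyclic: it admits at least one dense orbit. -/
def IsHypercyclic (T : H →L[ℂ] H) : Prop :=
  (hypercyclicVectors T).Nonempty

/-- The set of times `i` at which the orbit of `x` under `T` visits `S`. -/
def visitTimes (T : H →L[ℂ] H) (x : H) (S : Set H) : Set ℕ :=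
  {i : ℕ | (T ^ i) x ∈ S}

/-- The parameter `c(T)` of a hypercyclic operator `T`: the supremum over all hypercyclic vectors `x`
of the upper density of the set of times at which the orbit of `x` visits the open ball of radius
`α` centred at `0`. It does not depend on `α > 0` (see `cParam_eq`); the definition takes `α = 1`. -/
def cParam (T : H →L[ℂ] H) : ℝ :=
  ⨆ x : hypercyclicVectors T, upperDensity (visitTimes T (x : H) (Metric.ball 0 1))

theorem smul_mem_hypercyclicVectors (T : H →L[ℂ] H) {a : ℂ} (ha : a ≠ 0) {x : H}
    (hx : x ∈ hypercyclicVectors T) : a • x ∈ hypercyclicVectors T := by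
  have h := (Homeomorph.smulOfNeZero (α := H) a ha).surjective.denseRange.dense_image
    (Homeomorph.smulOfNeZero (α := H) a ha).continuous hx
  rw [← Set.range_comp] at h
  have he : (fun n : ℕ => (T ^ n) (a • x)) =
      Homeomorph.smulOfNeZero (α := H) a ha ∘ fun n : ℕ => (T ^ n) x := by
    funext n
    exact map_smul (T ^ n) a x
  change Dense (Set.range fun n : ℕ => (T ^ n) (a • x))
  rw [he]
  exact h

/-- The value of `c(T)` can be computed with a ball of any radius `α > 0`. -/
theorem cParam_eq (T : H →L[ℂ] H) {α : ℝ} (hα : 0 < α) :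
    cParam T =
      ⨆ x : hypercyclicVectors T, upperDensity (visitTimes T (x : H) (Metric.ball 0 α)) := by
  have hα' : (α : ℂ) ≠ 0 := by exact_mod_cast hα.ne'
  refine Function.Surjective.iSup_congr
    (fun x : hypercyclicVectors T =>
      (⟨(α : ℂ) • (x : H), smul_mem_hypercyclicVectors T hα' x.2⟩ : hypercyclicVectors T)) ?_ ?_
  · intro y
    exact ⟨⟨(α : ℂ)⁻¹ • (y : H), smul_mem_hypercyclicVectors T (inv_ne_zero hα') y.2⟩,
      Subtype.ext (by simp [smul_smul, hα'])⟩
  · intro x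
    congr 1
    ext i
    simp only [visitTimes, Set.mem_ofPred_eq, mem_ball_zero_iff, map_smul, norm_smul,
      Complex.norm_real, Real.norm_eq_abs, abs_of_pos hα]
    exact mul_lt_iff_lt_one_right hα

end Operators

section Ball

variable (H : Type*) [NormedAddCommGroup H] [InnerProductSpace ℂ H]

/-- The closed ball `{T : ‖T‖ ≤ M}` of the algebra of bounded operators on `H`. It is always
equipped with the strong-* operator topology (instance below). -/
def OperatorBall (M : ℝ) : Type _ := {T : H →L[ℂ] H // ‖T‖ ≤ M}

variable {H}

/-- The operator underlying a point of the ball. -/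
def OperatorBall.op {M : ℝ} (T : OperatorBall H M) : H →L[ℂ] H := T.1

/-- The strong-* operator topology: the coarsest one for which all the maps `T ↦ T x` and
`T ↦ T* x` into `H` (with its norm) are continuous. -/
instance OperatorBall.instTopologicalSpace [CompleteSpace H] (M : ℝ) :
    TopologicalSpace (OperatorBall H M) :=
  TopologicalSpace.induced
    (fun T => ((fun x : H => T.op x), fun x : H => ContinuousLinearMap.adjoint T.op x))
    (inferInstance : TopologicalSpace ((H → H) × (H → H)))

end Ball

end

end LinearDynamics

/-!
# Typical distributional chaos on a Hilbert space

By a diagonal argument (`exists_upperDensity_eq_one`), a vector `x` is distributionally irregular for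
`T` if and only if `(T, x)` satisfies countably many conditions of the form "for some `n ≥ N`, most of
the times `i ≤ n` satisfy `‖T ^ i x‖ < ε`" (`nearPairs`), respectively `‖T ^ i x‖ > k` (`farPairs`).
Since `(T, x) ↦ T ^ i x` is jointly continuous on the ball times `H`, these conditions are open; so are
the conditions "the orbit of `x` meets the open set `W`" (`visitPairs`), which express hypercyclicity.
For countably many open conditions on pairs, the operators for which each of them holds on a dense set
of vectors form a `Gδ` set (`isGδ_setOf_forall_dense_fibre`), and for such an operator Baire's theorem
in `H` gives a dense set of vectors satisfying all of them (`dense_setOf_forall_mem_fibre`). This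
identifies the densely distributionally chaotic operators with a `Gδ` set, and shows that another `Gδ`
set consists of hypercyclic operators `T` with `c(T) = 1`.

Both `Gδ` sets contain every operator `T` which has a dense set of vectors with orbit tending to `0`, a
right inverse `S` with `S ^ n → 0` pointwise, and an eigenvector for an eigenvalue larger than `1`
(`IsExpandingShift`). It remains to see that these operators are dense in the ball
(`dense_isExpandingShift`). Let `V` be an isometry with `V⋆ ^ n → 0` strongly, and let `P` be the
projection onto `ker (V⋆ ^ n)`. Given `T` in the ball, a multiple `A` of the compression `P T P` is
perturbed by a weighted block backward shift: `A + (d P + c (1 - P)) V⋆ ^ n`, with `d` small and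
`c = M - d`. As `n` grows and `d` tends to `0`, these operators converge to `T`, since `V⋆ ^ n` tends
strongly to `0` and its adjoint `V ^ n` enters on `ker (V⋆ ^ n)` only with the small weight `d`
(`tendsto_shiftApprox_apply`, `tendsto_star_shiftApprox_apply`). Their norm is at most `M` by
orthogonality (`norm_perturbedShift_le`). Because `M > 1`, the weight `c` may be taken larger than both
`1` and `‖A‖`; the weighted forward shift is then a right inverse whose powers decay faster than those
of `A` may grow, which yields the three properties (`isExpandingShift_perturbedShift`). In particular
hypercyclic operators are dense in the ball, so that comeagerness passes to the subspace they form
(`preimage_val_mem_residual`).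
-/

namespace LinearDynamics

open Filter Topology

noncomputable section

/-! ### Sets of upper density one -/

/-- `A` fills more than a proportion `1 - ε` of some initial interval `{1, …, n}` with `n ≥ N`. -/
def FillsInterval (A : Set ℕ) (ε : ℝ) (N : ℕ) : Prop :=
  ∃ n ≥ N, (1 - ε) * (n : ℝ) < ((A ∩ Set.Icc 1 n).ncard : ℝ)

theorem finite_inter_Icc (A : Set ℕ) (n : ℕ) : (A ∩ Set.Icc 1 n).Finite :=
  (Set.finite_Icc 1 n).inter_of_right A

theorem ncard_inter_Icc_le (A : Set ℕ) (n : ℕ) : (A ∩ Set.Icc 1 n).ncard ≤ n := by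
  have h := Set.ncard_le_ncard (Set.inter_subset_right : A ∩ Set.Icc 1 n ⊆ Set.Icc 1 n)
    (Set.finite_Icc 1 n)
  simpa [Set.ncard_eq_toFinset_card'] using h

theorem FillsInterval.mono {A B : Set ℕ} (h : A ⊆ B) {ε : ℝ} {N : ℕ} (hA : FillsInterval A ε N) :
    FillsInterval B ε N := by
  obtain ⟨n, hn, hlt⟩ := hA
  refine ⟨n, hn, hlt.trans_le ?_⟩
  exact_mod_cast Set.ncard_le_ncard (Set.inter_subset_inter_left _ h) (finite_inter_Icc B n)

theorem density_ratio_le_one (A : Set ℕ) (n : ℕ) :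
    ((A ∩ Set.Icc 1 n).ncard : ℝ) / (n : ℝ) ≤ 1 :=
  div_le_one_of_le₀ (by exact_mod_cast ncard_inter_Icc_le A n) n.cast_nonneg

theorem isBoundedUnder_density_ratio (A : Set ℕ) :
    IsBoundedUnder (· ≤ ·) atTop (fun n : ℕ => ((A ∩ Set.Icc 1 n).ncard : ℝ) / (n : ℝ)) :=
  isBoundedUnder_of ⟨1, density_ratio_le_one A⟩

theorem isCoboundedUnder_density_ratio (A : Set ℕ) :
    IsCoboundedUnder (· ≤ ·) atTop (fun n : ℕ => ((A ∩ Set.Icc 1 n).ncard : ℝ) / (n : ℝ)) :=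
  IsBoundedUnder.isCoboundedUnder_le (isBoundedUnder_of ⟨0, fun _ => by positivity⟩)

theorem upperDensity_le_one (A : Set ℕ) : upperDensity A ≤ 1 :=
  limsup_le_of_le (isCoboundedUnder_density_ratio A) (.of_forall (density_ratio_le_one A))

theorem upperDensity_eq_one_iff {A : Set ℕ} :
    upperDensity A = 1 ↔ ∀ ε > 0, ∀ N, FillsInterval A ε N := by
  constructor
  · intro h ε hε N
    have hlt : 1 - ε < upperDensity A := by linarith
    obtain ⟨n, hlt, hn⟩ := ((frequently_lt_of_lt_limsup (isCoboundedUnder_density_ratio A)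
      hlt).and_eventually (eventually_ge_atTop (N + 1))).exists
    refine ⟨n, by omega, ?_⟩
    have : (0 : ℝ) < n := by exact_mod_cast (by omega : 0 < n)
    exact (lt_div_iff₀ this).1 hlt
  · intro h
    refine le_antisymm (upperDensity_le_one A) (le_of_forall_sub_le fun ε hε => ?_)
    refine le_limsup_of_frequently_le (frequently_atTop.2 fun N => ?_)
      (isBoundedUnder_density_ratio A)
    obtain ⟨n, hn, hlt⟩ := h ε hε (N + 1)
    have : (0 : ℝ) < n := by exact_mod_cast (by omega : 0 < n)
    exact ⟨n, by omega, (le_div_iff₀ this).2 hlt.le⟩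

theorem upperDensity_univ : upperDensity Set.univ = 1 := by
  refine upperDensity_eq_one_iff.2 fun ε hε N => ⟨N + 1, by omega, ?_⟩
  simp only [Set.univ_inter, Set.ncard_eq_toFinset_card', Set.toFinset_Icc, Nat.card_Icc]
  push_cast
  nlinarith [(N.cast_nonneg : (0 : ℝ) ≤ N)]

/-- A set of upper density one keeps its density when finitely many of its elements are removed. -/
theorem FillsInterval.of_eventually {A B : Set ℕ} (hA : upperDensity A = 1)
    (h : ∀ᶠ i in atTop, i ∈ A → i ∈ B) {ε : ℝ} (hε : 0 < ε) (N : ℕ) : FillsInterval B ε N := by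
  obtain ⟨m, hm⟩ := eventually_atTop.1 h
  obtain ⟨K, hK⟩ := exists_nat_gt (2 * m / ε)
  obtain ⟨n, hn, hlt⟩ := upperDensity_eq_one_iff.1 hA (ε / 2) (by positivity) (max N K)
  refine ⟨n, le_of_max_le_left hn, ?_⟩
  have hsub : A ∩ Set.Icc 1 n ⊆ (B ∩ Set.Icc 1 n) ∪ Set.Icc 1 m := by
    rintro i ⟨hi, hi1, hin⟩
    rcases le_total m i with h | h
    · exact Or.inl ⟨hm i h hi, hi1, hin⟩
    · exact Or.inr ⟨hi1, h⟩
  have hcard : (A ∩ Set.Icc 1 n).ncard ≤ (B ∩ Set.Icc 1 n).ncard + m := by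
    refine (Set.ncard_le_ncard hsub ((finite_inter_Icc B n).union (Set.finite_Icc 1 m))).trans
      ((Set.ncard_union_le _ _).trans ?_)
    simp [Set.ncard_eq_toFinset_card']
  have hcard' : ((A ∩ Set.Icc 1 n).ncard : ℝ) ≤ (B ∩ Set.Icc 1 n).ncard + m := by
    exact_mod_cast hcard
  have hKn : (K : ℝ) ≤ n := by exact_mod_cast le_of_max_le_right hn
  have : 2 * m < ε * n := by
    rw [div_lt_iff₀ hε] at hK
    nlinarith
  nlinarith

/-- Diagonal argument: a decreasing sequence of sets which all have upper density one has a
pseudo-intersection of upper density one. -/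
theorem exists_upperDensity_eq_one {A : ℕ → Set ℕ} (hA : Antitone A)
    (h : ∀ k N : ℕ, FillsInterval (A k) (1 / (k + 1)) N) :
    ∃ B : Set ℕ, upperDensity B = 1 ∧ ∀ k, ∀ᶠ i in atTop, i ∈ B → i ∈ A k := by
  choose n hn hlt using h
  -- `m (k + 1)` is the length of an interval, longer than `m k`, which `A k` almost fills.
  let m : ℕ → ℕ := fun k => Nat.rec 0 (fun k r => n k (r + 1)) k
  have hm : ∀ k, m (k + 1) = n k (m k + 1) := fun k => rfl
  have hmono : StrictMono m := strictMono_nat_of_lt_succ fun k => by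
    rw [hm]; exact hn k (m k + 1)
  refine ⟨{i | ∀ k, m k < i → i ∈ A k}, ?_, fun k => ?_⟩
  · refine upperDensity_eq_one_iff.2 fun ε hε N => ?_
    obtain ⟨K, hK⟩ := exists_nat_one_div_lt hε
    let k := max N K
    refine FillsInterval.mono (A := A k ∩ Set.Icc 1 (m (k + 1))) ?_ ⟨m (k + 1), ?_, ?_⟩
    · rintro i ⟨hi, -, hik⟩ j hj
      have hjk : j < k + 1 := hmono.lt_iff_lt.1 (hj.trans_le hik)
      exact hA (by omega) hi
    · exact ((le_max_left N K).trans (Nat.le_succ _)).trans (hmono.le_apply)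
    · rw [Set.inter_assoc, Set.inter_self]
      have h1 := hlt k (m k + 1)
      rw [← hm] at h1
      refine lt_of_le_of_lt ?_ h1
      have h2 : (1 : ℝ) / (k + 1) ≤ 1 / (K + 1) :=
        one_div_le_one_div_of_le (by positivity)
          (by gcongr; exact le_max_right N K)
      gcongr
      linarith
  · filter_upwards [eventually_gt_atTop (m k)] with i hi hB using hB k hi

theorem isOpen_setOf_fillsInterval {Y : Type*} [TopologicalSpace Y] {A : Y → Set ℕ}
    (hA : ∀ i, IsOpen {y | i ∈ A y}) (ε : ℝ) (N : ℕ) :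
    IsOpen {y | FillsInterval (A y) ε N} := by
  have : {y | FillsInterval (A y) ε N} = ⋃ n ≥ N, ⋃ F : Finset ℕ,
      ⋃ (_ : F ⊆ Finset.Icc 1 n ∧ (1 - ε) * (n : ℝ) < F.card), ⋂ i ∈ F, {y | i ∈ A y} := by
    ext y
    simp only [Set.mem_iUnion, Set.mem_iInter, Set.mem_ofPred_eq, exists_prop, FillsInterval]
    refine exists_congr fun n => and_congr_right fun _ => ?_
    constructor
    · intro h
      refine ⟨(finite_inter_Icc (A y) n).toFinset, ⟨?_, ?_⟩, ?_⟩
      · intro i hi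
        simpa using (((finite_inter_Icc (A y) n).mem_toFinset).1 hi).2
      · rwa [← Set.ncard_eq_toFinset_card _ (finite_inter_Icc (A y) n)]
      · intro i hi
        exact (((finite_inter_Icc (A y) n).mem_toFinset).1 hi).1
    · rintro ⟨F, ⟨hF, hlt⟩, hFA⟩
      refine hlt.trans_le ?_
      have hsub : (F : Set ℕ) ⊆ A y ∩ Set.Icc 1 n := fun i hi =>
        ⟨hFA i hi, by simpa using hF hi⟩
      rw [← Set.ncard_coe_finset]
      exact_mod_cast Set.ncard_le_ncard hsub (finite_inter_Icc (A y) n)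
  rw [this]
  exact isOpen_iUnion fun n => isOpen_iUnion fun _ => isOpen_iUnion fun F => isOpen_iUnion fun _ =>
    isOpen_biInter_finset fun i _ => hA i

theorem exists_tendsto_zero_iff_fillsInterval {u : ℕ → ℝ} (hu : ∀ i, 0 ≤ u i) :
    (∃ A : Set ℕ, upperDensity A = 1 ∧ Tendsto u (atTop ⊓ 𝓟 A) (𝓝 0)) ↔
      ∀ k N : ℕ, FillsInterval {i | u i < 1 / ((k : ℝ) + 1)} (1 / ((k : ℝ) + 1)) N := by
  constructor
  · rintro ⟨A, hA, hlim⟩ k N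
    have hk : (0 : ℝ) < 1 / ((k : ℝ) + 1) := by positivity
    exact .of_eventually hA (eventually_inf_principal.1 (hlim.eventually_lt_const hk)) hk N
  · intro h
    have hanti : Antitone fun k : ℕ => {i | u i < 1 / ((k : ℝ) + 1)} := fun k l hkl i hi =>
      lt_of_lt_of_le (show u i < 1 / ((l : ℝ) + 1) from hi) (one_div_le_one_div_of_le (by positivity) (by gcongr))
    obtain ⟨A, hA, hAk⟩ := exists_upperDensity_eq_one hanti h
    refine ⟨A, hA, tendsto_order.2 ⟨fun a ha => .of_forall fun i => ha.trans_le (hu i), ?_⟩⟩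
    intro a ha
    obtain ⟨k, hk⟩ := exists_nat_one_div_lt ha
    refine eventually_inf_principal.2 ((hAk k).mono fun i hi hiA => ?_)
    exact lt_trans (hi hiA) hk

theorem exists_tendsto_atTop_iff_fillsInterval {u : ℕ → ℝ} :
    (∃ A : Set ℕ, upperDensity A = 1 ∧ Tendsto u (atTop ⊓ 𝓟 A) atTop) ↔
      ∀ k N : ℕ, FillsInterval {i | (k : ℝ) < u i} (1 / ((k : ℝ) + 1)) N := by
  constructor
  · rintro ⟨A, hA, hlim⟩ k N
    exact .of_eventually hA (eventually_inf_principal.1 (hlim.eventually_gt_atTop (k : ℝ)))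
      (by positivity) N
  · intro h
    have hanti : Antitone fun k : ℕ => {i | (k : ℝ) < u i} := fun k l hkl i hi =>
      lt_of_le_of_lt (by gcongr) (show (l : ℝ) < u i from hi)
    obtain ⟨A, hA, hAk⟩ := exists_upperDensity_eq_one hanti h
    refine ⟨A, hA, tendsto_atTop.2 fun a => ?_⟩
    obtain ⟨k, hk⟩ := exists_nat_gt a
    refine eventually_inf_principal.2 ((hAk k).mono fun i hi hiA => ?_)
    exact (lt_trans hk (hi hiA)).le

/-! ### Conditions that hold for a dense set of points in every fibre -/

section Fibres

variable {X Y ι : Type*} [TopologicalSpace X] [TopologicalSpace Y] [Countable ι]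
  {O : ι → Set (X × Y)}

/-- Density of a fibre is tested on a countable basis `V`, and the points whose fibre meets `V` form the
projection of an open set. -/
theorem isGδ_setOf_forall_dense_fibre [SecondCountableTopology Y] (hO : ∀ i, IsOpen (O i)) :
    IsGδ {x | ∀ i, Dense {y | (x, y) ∈ O i}} := by
  have : {x | ∀ i, Dense {y | (x, y) ∈ O i}} =
      ⋂ i, ⋂ V ∈ TopologicalSpace.countableBasis Y, Prod.fst '' (O i ∩ Prod.snd ⁻¹' V) := by
    ext x
    simp only [Set.mem_iInter, Set.mem_ofPred_eq]
    refine forall_congr' fun i => ?_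
    rw [(TopologicalSpace.isBasis_countableBasis Y).dense_iff]
    refine forall₂_congr fun V hV => ?_
    constructor
    · intro h
      obtain ⟨y, hyV, hy⟩ := h (TopologicalSpace.nonempty_of_mem_countableBasis hV)
      exact ⟨(x, y), ⟨hy, hyV⟩, rfl⟩
    · rintro ⟨⟨x', y⟩, ⟨hy, hyV⟩, rfl⟩ -
      exact ⟨y, hyV, hy⟩
  rw [this]
  refine .iInter fun i => .biInter (TopologicalSpace.countable_countableBasis Y) fun V hV => ?_
  refine (isOpenMap_fst _ ((hO i).inter ?_)).isGδ
  exact (TopologicalSpace.isOpen_of_mem_countableBasis hV).preimage continuous_snd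

theorem dense_setOf_forall_mem_fibre [BaireSpace Y] (hO : ∀ i, IsOpen (O i)) {x : X}
    (hx : ∀ i, Dense {y | (x, y) ∈ O i}) : Dense {y | ∀ i, (x, y) ∈ O i} := by
  have h := dense_iInter_of_isOpen (fun i => (hO i).preimage (Continuous.prodMk_right x)) hx
  convert h using 1
  ext y
  simp

end Fibres

section Operators

variable {H : Type*} [NormedAddCommGroup H] [InnerProductSpace ℂ H]

/-! ### Irregular orbits through interval counts -/

theorem isDistributionallyIrregular_iff {T : H →L[ℂ] H} {x : H} :
    IsDistributionallyIrregular T x ↔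
      (∀ k N : ℕ, FillsInterval {i | ‖(T ^ i) x‖ < 1 / ((k : ℝ) + 1)} (1 / ((k : ℝ) + 1)) N) ∧
      ∀ k N : ℕ, FillsInterval {i | (k : ℝ) < ‖(T ^ i) x‖} (1 / ((k : ℝ) + 1)) N := by
  rw [← exists_tendsto_zero_iff_fillsInterval (fun _ => norm_nonneg _),
    ← exists_tendsto_atTop_iff_fillsInterval]
  constructor
  · rintro ⟨A, B, hA, hB, h0, h1⟩
    exact ⟨⟨A, hA, h0⟩, ⟨B, hB, h1⟩⟩
  · rintro ⟨⟨A, hA, h0⟩, ⟨B, hB, h1⟩⟩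
    exact ⟨A, B, hA, hB, h0, h1⟩

theorem cParam_eq_one {T : H →L[ℂ] H} {x : H} (hx : x ∈ hypercyclicVectors T)
    (h : ∀ k N : ℕ, FillsInterval {i | ‖(T ^ i) x‖ < 1 / ((k : ℝ) + 1)} (1 / ((k : ℝ) + 1)) N) :
    cParam T = 1 := by
  have hd : upperDensity (visitTimes T x (Metric.ball 0 1)) = 1 := by
    obtain ⟨A, hA, hlim⟩ := (exists_tendsto_zero_iff_fillsInterval (fun _ => norm_nonneg _)).2 h
    refine upperDensity_eq_one_iff.2 fun ε hε N => .of_eventually hA ?_ hε N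
    simpa [visitTimes] using eventually_inf_principal.1 (hlim.eventually_lt_const one_pos)
  have : Nonempty (hypercyclicVectors T) := ⟨⟨x, hx⟩⟩
  refine le_antisymm (ciSup_le fun _ => upperDensity_le_one _) ?_
  refine le_ciSup_of_le ⟨1, ?_⟩ ⟨x, hx⟩ hd.ge
  rintro _ ⟨y, rfl⟩
  exact upperDensity_le_one _

/-! ### A criterion for chaotic behaviour -/

/-- The hypotheses of Kitai's criterion, with a bounded right inverse defined everywhere, together
with an eigenvector for an eigenvalue larger than `1`. -/
structure IsExpandingShift (T : H →L[ℂ] H) : Prop where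
  dense_tendsto_zero : Dense {x : H | Tendsto (fun n : ℕ => (T ^ n) x) atTop (𝓝 0)}
  exists_rightInverse : ∃ S : H →L[ℂ] H, T * S = 1 ∧
    ∀ x, Tendsto (fun n : ℕ => (S ^ n) x) atTop (𝓝 0)
  exists_eigenvector : ∃ r : ℝ, 1 < r ∧ ∃ y : H, y ≠ 0 ∧ T y = (r : ℂ) • y

theorem pow_mul_pow_eq_one {R : Type*} [Monoid R] {a b : R} (h : a * b = 1) (n : ℕ) :
    a ^ n * b ^ n = 1 := by
  induction n with
  | zero => simp
  | succ n ih => rw [pow_succ, pow_succ', mul_assoc, ← mul_assoc a b, h, one_mul, ih]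

namespace IsExpandingShift

variable {T : H →L[ℂ] H}

theorem dense_near (h : IsExpandingShift T) (k N : ℕ) :
    Dense {x | FillsInterval {i | ‖(T ^ i) x‖ < 1 / ((k : ℝ) + 1)} (1 / ((k : ℝ) + 1)) N} := by
  refine h.dense_tendsto_zero.mono fun x hx => ?_
  have hx' : Tendsto (fun i : ℕ => ‖(T ^ i) x‖) atTop (𝓝 0) := tendsto_zero_iff_norm_tendsto_zero.1 hx
  exact (exists_tendsto_zero_iff_fillsInterval (fun _ => norm_nonneg _)).1
    ⟨Set.univ, upperDensity_univ, by simpa using hx'⟩ k N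

theorem dense_tendsto_atTop (h : IsExpandingShift T) :
    Dense {x | Tendsto (fun i : ℕ => ‖(T ^ i) x‖) atTop atTop} := by
  obtain ⟨r, hr, y, hy, hTy⟩ := h.exists_eigenvector
  have hpow : ∀ n : ℕ, (T ^ n) y = (r : ℂ) ^ n • y := by
    intro n
    induction n with
    | zero => simp
    | succ n ih => rw [pow_succ, mul_apply_eq_comp, hTy, map_smul, ih, smul_smul,
        pow_succ']
  -- A vector whose orbit tends to `0` is the limit of its perturbations by small multiples of the
  -- eigenvector, whose orbits tend to infinity.
  refine dense_closure.1 (h.dense_tendsto_zero.mono fun x hx => ?_)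
  have hlim : Tendsto (fun j : ℕ => x + (((j : ℝ) + 1)⁻¹ : ℝ) • y) atTop (𝓝 x) := by
    have := (tendsto_one_div_add_atTop_nhds_zero_nat (𝕜 := ℝ)).smul_const y
    simpa using this.const_add x
  refine mem_closure_of_tendsto hlim (.of_forall fun j => ?_)
  have hj : (0 : ℝ) < ((j : ℝ) + 1)⁻¹ := by positivity
  generalize ((j : ℝ) + 1)⁻¹ = s at hj
  have h1 : Tendsto (fun i : ℕ => r ^ i * (s * ‖y‖)) atTop atTop :=
    (tendsto_pow_atTop_atTop_of_one_lt hr).atTop_mul_const (mul_pos hj (norm_pos_iff.2 hy))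
  have h2 : Tendsto (fun i : ℕ => -‖(T ^ i) x‖) atTop (𝓝 0) := by
    simpa using (tendsto_zero_iff_norm_tendsto_zero.1 hx).neg
  refine tendsto_atTop_mono (fun i => ?_) (h1.atTop_add h2)
  have h3 : (T ^ i) (x + s • y) = (T ^ i) x + (s : ℂ) • (r : ℂ) ^ i • y := by
    rw [map_add, ← hpow, ← map_smul]
    rfl
  have h4 : ‖(s : ℂ) • (r : ℂ) ^ i • y‖ = r ^ i * (s * ‖y‖) := by
    rw [norm_smul, norm_smul, norm_pow, Complex.norm_real, Complex.norm_real, Real.norm_of_nonneg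
      hj.le, Real.norm_of_nonneg (by linarith)]
    ring
  have h5 := norm_sub_le ((T ^ i) (x + s • y)) ((T ^ i) x)
  rw [h3, add_sub_cancel_left, h4, ← h3] at h5
  linarith

theorem dense_far (h : IsExpandingShift T) (k N : ℕ) :
    Dense {x | FillsInterval {i | (k : ℝ) < ‖(T ^ i) x‖} (1 / ((k : ℝ) + 1)) N} :=
  h.dense_tendsto_atTop.mono fun x hx =>
    exists_tendsto_atTop_iff_fillsInterval.1
      ⟨Set.univ, upperDensity_univ, by simpa using hx⟩ k N

theorem dense_visit (h : IsExpandingShift T) {V : Set H} (hV : IsOpen V) (hne : V.Nonempty) :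
    Dense {x | ∃ n : ℕ, (T ^ n) x ∈ V} := by
  obtain ⟨S, hTS, hS⟩ := h.exists_rightInverse
  obtain ⟨v, hv⟩ := hne
  refine dense_closure.1 (h.dense_tendsto_zero.mono fun x hx => ?_)
  have hlim : Tendsto (fun n : ℕ => x + (S ^ n) v) atTop (𝓝 x) := by
    simpa using (hS v).const_add x
  have hlim' : Tendsto (fun n : ℕ => (T ^ n) (x + (S ^ n) v)) atTop (𝓝 v) := by
    have h1 : ∀ n : ℕ, (T ^ n) (x + (S ^ n) v) = (T ^ n) x + v := fun n => by
      rw [map_add, ← mul_apply_eq_comp, pow_mul_pow_eq_one hTS,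
        one_apply_eq_self]
    simp only [h1]
    simpa using Tendsto.add_const v hx
  exact mem_closure_of_tendsto hlim
    ((hlim'.eventually (hV.mem_nhds hv)).mono fun n hn => ⟨n, hn⟩)

end IsExpandingShift

end Operators

section Shift

variable {H : Type*} [NormedAddCommGroup H] [InnerProductSpace ℂ H]

/-! ### Perturbed weighted backward shifts -/

/-- For operators `J`, `B` with `B J = 1`, thought of as a forward shift and the corresponding
backward shift, and `P = 1 - J B` the projection onto `ker B`, the operator `A + (d P + c (1 - P)) B`:
a weighted backward shift with weight `d` on the first block and `c` on the others, perturbed by an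
operator `A` on the first block. -/
def perturbedShift (J B A : H →L[ℂ] H) (d c : ℂ) : H →L[ℂ] H :=
  A + d • ((1 - J * B) * B) + c • (J * B * B)

/-- The weighted forward shift which is a right inverse of `perturbedShift J B A d c`. -/
def perturbedShiftInv (J B : H →L[ℂ] H) (d c : ℂ) : H →L[ℂ] H :=
  J * (d⁻¹ • (1 - J * B) + c⁻¹ • (J * B))

variable {J B A : H →L[ℂ] H} {d c : ℂ}

theorem perturbedShift_mul_inv (hBJ : B * J = 1) (hAJ : A * J = 0) (hd : d ≠ 0) (hc : c ≠ 0) :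
    perturbedShift J B A d c * perturbedShiftInv J B d c = 1 := by
  have h : perturbedShift J B A d c * J = d • (1 - J * B) + c • (J * B) := by
    simp only [perturbedShift, add_mul, smul_mul_assoc, mul_assoc, hAJ, hBJ, mul_one, zero_add]
  have h1 : J * B * (J * B) = J * B := by rw [mul_assoc, ← mul_assoc B J, hBJ, one_mul]
  have h2 : (1 - J * B) * (J * B) = 0 := by rw [sub_mul, h1, one_mul, sub_self]
  have h3 : (J * B) * (1 - J * B) = 0 := by rw [mul_sub, h1, mul_one, sub_self]
  have h4 : (1 - J * B) * (1 - J * B) = 1 - J * B := by rw [mul_sub, h2, mul_one, sub_zero]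
  rw [perturbedShiftInv, ← mul_assoc, h, add_mul, mul_add, mul_add]
  simp only [smul_mul_smul_comm, h1, h2, h3, h4, mul_inv_cancel₀ hd, mul_inv_cancel₀ hc]
  simp

theorem perturbedShiftInv_pow_succ (hBJ : B * J = 1) (n : ℕ) :
    perturbedShiftInv J B d c ^ (n + 1) =
      (c⁻¹) ^ n • (J ^ (n + 1) * (d⁻¹ • (1 - J * B) + c⁻¹ • (J * B))) := by
  have h : (d⁻¹ • (1 - J * B) + c⁻¹ • (J * B)) * J = c⁻¹ • J := by
    simp only [add_mul, smul_mul_assoc, sub_mul, mul_assoc, hBJ, mul_one, one_mul, sub_self,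
      smul_zero, zero_add]
  induction n with
  | zero => simp [perturbedShiftInv]
  | succ n ih =>
    rw [pow_succ, ih, perturbedShiftInv, smul_mul_assoc, mul_assoc, ← mul_assoc _ J, h,
      smul_mul_assoc, mul_smul_comm, smul_smul, ← pow_succ, ← mul_assoc, ← pow_succ]

theorem norm_perturbedShiftInv_pow_succ_le (hBJ : B * J = 1) (hJ : ‖J‖ ≤ 1) {c : ℝ} (hc : 0 < c) :
    ∃ C : ℝ, ∀ (n : ℕ) (x : H), ‖(perturbedShiftInv J B d c ^ (n + 1)) x‖ ≤ C * (c⁻¹) ^ n * ‖x‖ := by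
  refine ⟨‖d⁻¹ • (1 - J * B) + (c : ℂ)⁻¹ • (J * B)‖, fun n x => ?_⟩
  rw [perturbedShiftInv_pow_succ hBJ]
  refine (ContinuousLinearMap.le_opNorm _ x).trans ?_
  gcongr
  rw [norm_smul, norm_pow, norm_inv, Complex.norm_real, Real.norm_of_nonneg hc.le, mul_comm]
  gcongr
  refine (norm_mul_le _ _).trans (mul_le_of_le_one_left (norm_nonneg _) ?_)
  exact (norm_pow_le' J n.succ_pos).trans (pow_le_one₀ (norm_nonneg _) hJ)

theorem mul_perturbedShift (hBJ : B * J = 1) (hBA : B * A = 0) :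
    B * perturbedShift J B A d c = c • (B * B) := by
  have h : B * (1 - J * B) = 0 := by rw [mul_sub, ← mul_assoc, hBJ, one_mul, mul_one, sub_self]
  rw [perturbedShift, mul_add, mul_add, hBA, mul_smul_comm, mul_smul_comm, ← mul_assoc, h,
    mul_assoc J, ← mul_assoc B J, hBJ]
  simp

theorem mul_perturbedShift_pow (hBJ : B * J = 1) (hBA : B * A = 0) (n : ℕ) :
    B * perturbedShift J B A d c ^ n = c ^ n • B ^ (n + 1) := by
  induction n with
  | zero => simp
  | succ n ih =>
    rw [pow_succ, ← mul_assoc, ih, smul_mul_assoc, pow_succ B, mul_assoc,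
      mul_perturbedShift hBJ hBA, mul_smul_comm, smul_smul, ← pow_succ, ← mul_assoc, ← pow_succ,
      ← pow_succ]

/-- On `ker B` the perturbed shift coincides with `A`. -/
theorem perturbedShift_pow_apply (hBA : B * A = 0) {y : H} (hy : B y = 0) (n : ℕ) :
    (perturbedShift J B A d c ^ n) y = (A ^ n) y ∧ B ((A ^ n) y) = 0 := by
  induction n with
  | zero => simp [hy]
  | succ n ih =>
    rw [pow_succ', pow_succ', mul_apply_eq_comp, mul_apply_eq_comp, ih.1]
    refine ⟨?_, ?_⟩
    · simp only [perturbedShift, add_apply, smul_apply, mul_apply_eq_comp, ih.2, map_zero, smul_zero,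
        add_zero]
    · rw [← mul_apply_eq_comp, hBA]
      rfl

theorem perturbedShift_dense_tendsto_zero {c : ℝ} (hBJ : B * J = 1) (hJ : ‖J‖ ≤ 1)
    (hAJ : A * J = 0) (hBA : B * A = 0) (hd : d ≠ 0) (hc : 0 < c) (hAc : ‖A‖ < c)
    (hB : Dense {x : H | ∀ᶠ n : ℕ in atTop, (B ^ n) x = 0}) :
    Dense {x : H | Tendsto (fun n : ℕ => (perturbedShift J B A d c ^ n) x) atTop (𝓝 0)} := by
  have hc' : (c : ℂ) ≠ 0 := by exact_mod_cast hc.ne'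
  obtain ⟨C, hC⟩ := norm_perturbedShiftInv_pow_succ_le (d := d) hBJ hJ hc
  have hTS := perturbedShift_mul_inv hBJ hAJ hd hc'
  have hBT := mul_perturbedShift_pow (d := d) (c := (c : ℂ)) hBJ hBA
  have hker := fun y hy n => (perturbedShift_pow_apply (J := J) (d := d) (c := (c : ℂ)) hBA
    (y := y) hy n).1
  generalize perturbedShift J B A d c = T at *
  generalize perturbedShiftInv J B d c = S at *
  have hC0 : ∀ (n : ℕ) (x : H), ‖(S ^ (n + 1)) x‖ ≤ |C| * (c⁻¹) ^ n * ‖x‖ := fun n x =>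
    (hC n x).trans (by gcongr; exact le_abs_self C)
  refine dense_closure.1 (hB.mono fun x hx => ?_)
  obtain ⟨m, hm⟩ := eventually_atTop.1 hx
  -- The vectors `x - S ^ n (T ^ n x)` are killed by `T ^ n`, and they converge to `x`: the orbit of
  -- `x` enters `ker B`, after which it grows like the powers of `A`, while `S ^ n` decays like
  -- `c ^ (-n)`.
  have hy : B ((T ^ m) x) = 0 := by
    rw [← mul_apply_eq_comp, hBT, smul_apply, hm _ m.le_succ, smul_zero]
  have hbound : ∀ j : ℕ, ‖(S ^ (j + m + 1)) ((T ^ (j + m + 1)) x)‖ ≤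
      (|C| * (c⁻¹) ^ m * ‖A‖ * ‖(T ^ m) x‖) * (‖A‖ / c) ^ j := fun j => by
    have h1 : (T ^ (j + m + 1)) x = (A ^ (j + 1)) ((T ^ m) x) := by
      rw [← hker _ hy, ← mul_apply_eq_comp, ← pow_add]
      congr 2
      ring
    have h2 : ‖(A ^ (j + 1)) ((T ^ m) x)‖ ≤ ‖A‖ ^ (j + 1) * ‖(T ^ m) x‖ :=
      (ContinuousLinearMap.le_opNorm _ _).trans (by gcongr; exact norm_pow_le' A j.succ_pos)
    calc _ ≤ |C| * (c⁻¹) ^ (j + m) * ‖(T ^ (j + m + 1)) x‖ := hC0 _ _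
      _ ≤ |C| * (c⁻¹) ^ (j + m) * (‖A‖ ^ (j + 1) * ‖(T ^ m) x‖) := by
        rw [h1]; gcongr
      _ = _ := by rw [div_eq_mul_inv, mul_pow, pow_add, pow_succ]; ring
  have hlim0 : Tendsto (fun j : ℕ => (S ^ (j + m + 1)) ((T ^ (j + m + 1)) x)) atTop (𝓝 0) := by
    refine squeeze_zero_norm hbound ?_
    have := tendsto_pow_atTop_nhds_zero_of_lt_one (div_nonneg (norm_nonneg A) hc.le)
      ((div_lt_one hc).2 hAc)
    simpa using this.const_mul (|C| * (c⁻¹) ^ m * ‖A‖ * ‖(T ^ m) x‖)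
  have hlim : Tendsto (fun j : ℕ => x - (S ^ (j + m + 1)) ((T ^ (j + m + 1)) x)) atTop (𝓝 x) := by
    simpa using hlim0.const_sub x
  refine mem_closure_of_tendsto hlim (.of_forall fun j => ?_)
  generalize j + m + 1 = n
  have hzero : (T ^ n) (x - (S ^ n) ((T ^ n) x)) = 0 := by
    rw [map_sub, ← mul_apply_eq_comp, pow_mul_pow_eq_one hTS, one_apply_eq_self, sub_self]
  refine tendsto_const_nhds.congr' (eventually_atTop.2 ⟨n, fun i hi => ?_⟩)
  obtain ⟨k, rfl⟩ := Nat.exists_eq_add_of_le' hi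
  simp only [pow_add, mul_apply_eq_comp, hzero, map_zero]

theorem perturbedShift_exists_eigenvector [CompleteSpace H] {c : ℝ} (hBJ : B * J = 1)
    (hJ : ‖J‖ ≤ 1) (hAJ : A * J = 0) (hd : d ≠ 0) (hc : 1 < c) {u : H} (hu : u ≠ 0)
    (hBu : B u = 0) :
    ∃ r : ℝ, 1 < r ∧ ∃ y : H, y ≠ 0 ∧ perturbedShift J B A d c y = (r : ℂ) • y := by
  have hc0 : 0 < c := by linarith
  have hc' : (c : ℂ) ≠ 0 := by exact_mod_cast hc0.ne'
  obtain ⟨r, hr1, hrc⟩ := exists_between hc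
  obtain ⟨C, hC⟩ := norm_perturbedShiftInv_pow_succ_le (d := d) hBJ hJ hc0
  have hTS := perturbedShift_mul_inv hBJ hAJ hd hc'
  -- `ker B` meets the range of `J`, hence the range of the right inverse, only in `0`.
  have hz0 : u - perturbedShiftInv J B d c (perturbedShift J B A d c u) ≠ 0 := by
    intro h
    apply hu
    rw [sub_eq_zero, perturbedShiftInv, mul_apply_eq_comp] at h
    have h2 := congrArg B h
    rw [hBu, ← mul_apply_eq_comp, hBJ, one_apply_eq_self] at h2
    rw [h, ← h2, map_zero]
  have hTz : perturbedShift J B A d c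
      (u - perturbedShiftInv J B d c (perturbedShift J B A d c u)) = 0 := by
    rw [map_sub, ← mul_apply_eq_comp, hTS, one_apply_eq_self, sub_self]
  generalize perturbedShift J B A d c = T at *
  generalize perturbedShiftInv J B d c = S at *
  generalize u - S (T u) = z at *
  -- The eigenvector is `∑ r ^ n S ^ n z` for a nonzero `z ∈ ker T`.
  have hsum : Summable fun n : ℕ => (r : ℂ) ^ n • (S ^ n) z := by
    rw [← summable_nat_add_iff 1]
    have hgeom : Summable fun n : ℕ => (r * C * ‖z‖) * (r / c) ^ n :=
      (summable_geometric_of_lt_one (div_nonneg (by linarith) hc0.le)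
        ((div_lt_one hc0).2 hrc)).mul_left _
    refine hgeom.of_norm_bounded fun n => ?_
    rw [norm_smul, norm_pow, Complex.norm_real, Real.norm_of_nonneg (by linarith)]
    calc r ^ (n + 1) * ‖(S ^ (n + 1)) z‖ ≤ r ^ (n + 1) * (C * (c⁻¹) ^ n * ‖z‖) := by
          gcongr
          exact hC n z
      _ = _ := by rw [div_eq_mul_inv, mul_pow, pow_succ]; ring
  have hstep : ∀ n : ℕ, T ((r : ℂ) ^ (n + 1) • (S ^ (n + 1)) z) =
      (r : ℂ) • ((r : ℂ) ^ n • (S ^ n) z) := fun n => by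
    rw [map_smul, pow_succ' S, ← mul_apply_eq_comp, ← mul_assoc, hTS, one_mul, smul_smul, pow_succ']
  refine ⟨r, hr1, ∑' n : ℕ, (r : ℂ) ^ n • (S ^ n) z, fun h0 => hz0 ?_, ?_⟩
  · have h1 : ∑' n : ℕ, (r : ℂ) ^ (n + 1) • (S ^ (n + 1)) z = 0 := by
      have h2 : ∀ n : ℕ, (r : ℂ) ^ (n + 1) • (S ^ (n + 1)) z =
          ((r : ℂ) • S) ((r : ℂ) ^ n • (S ^ n) z) := fun n => by
        rw [smul_apply, map_smul, smul_smul, ← pow_succ', ← mul_apply_eq_comp,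
          ← pow_succ']
      simp only [h2]
      rw [← ContinuousLinearMap.map_tsum _ hsum, h0, map_zero]
    rw [hsum.tsum_eq_zero_add, h1] at h0
    simpa using h0
  · have hsum' : Summable fun n : ℕ => T ((r : ℂ) ^ n • (S ^ n) z) := hsum.map T T.continuous
    rw [ContinuousLinearMap.map_tsum _ hsum, hsum'.tsum_eq_zero_add]
    simp only [hstep]
    rw [hsum.tsum_const_smul]
    simp [hTz]

theorem isExpandingShift_perturbedShift [CompleteSpace H] {c : ℝ} (hBJ : B * J = 1) (hJ : ‖J‖ ≤ 1)
    (hAJ : A * J = 0) (hBA : B * A = 0) (hd : d ≠ 0) (hc : 1 < c) (hAc : ‖A‖ < c)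
    (hB : Dense {x : H | ∀ᶠ n : ℕ in atTop, (B ^ n) x = 0}) {u : H} (hu : u ≠ 0) (hBu : B u = 0) :
    IsExpandingShift (perturbedShift J B A d c) where
  dense_tendsto_zero :=
    perturbedShift_dense_tendsto_zero hBJ hJ hAJ hBA hd (by linarith) hAc hB
  exists_rightInverse := by
    have hc0 : 0 < c := by linarith
    refine ⟨perturbedShiftInv J B d c,
      perturbedShift_mul_inv hBJ hAJ hd (by exact_mod_cast hc0.ne'), fun x => ?_⟩
    obtain ⟨C, hC⟩ := norm_perturbedShiftInv_pow_succ_le (d := d) hBJ hJ hc0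
    rw [← tendsto_add_atTop_iff_nat 1]
    refine squeeze_zero_norm (fun n => hC n x) ?_
    have := tendsto_pow_atTop_nhds_zero_of_lt_one (inv_nonneg.2 hc0.le) (inv_lt_one_of_one_lt₀ hc)
    simpa using (this.const_mul C).mul_const ‖x‖
  exists_eigenvector := perturbedShift_exists_eigenvector hBJ hJ hAJ hd hc hu hBu

variable [CompleteSpace H]

theorem norm_sq_add_norm_sq_star (hBJ : star J * J = 1) (x : H) :
    ‖(1 - J * star J) x‖ ^ 2 + ‖(star J) x‖ ^ 2 = ‖x‖ ^ 2 := by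
  have hiso : ∀ y, ‖J y‖ = ‖y‖ :=
    (ContinuousLinearMap.norm_map_iff_adjoint_comp_self J).2 hBJ
  have horth : inner ℂ ((1 - J * star J) x) (J ((star J) x)) = 0 := by
    rw [← ContinuousLinearMap.adjoint_inner_left, ← ContinuousLinearMap.star_eq_adjoint,
      ← mul_apply_eq_comp (star J), mul_sub, ← mul_assoc, hBJ]
    simp
  have h := norm_add_sq_eq_norm_sq_add_norm_sq_of_inner_eq_zero _ _ horth
  rw [hiso] at h
  rw [pow_two, pow_two, ← h]
  simp [pow_two]

/-- The operator `A` and the part of weight `c` have orthogonal ranges and orthogonal supports, so only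
the small weight `e` adds to the norm. -/
theorem norm_perturbedShift_le {c e : ℝ} (hBJ : star J * J = 1) (hAJ : A * J = 0)
    (hBA : star J * A = 0) (hAc : ‖A‖ ≤ c) (he : 0 ≤ e) :
    ‖perturbedShift J (star J) A e c‖ ≤ c + e := by
  have hc : 0 ≤ c := (norm_nonneg A).trans hAc
  have hiso : ∀ y, ‖J y‖ = ‖y‖ :=
    (ContinuousLinearMap.norm_map_iff_adjoint_comp_self J).2 hBJ
  have hP := norm_sq_add_norm_sq_star hBJ
  have hP1 : ∀ x, ‖(1 - J * star J) x‖ ≤ ‖x‖ := fun x =>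
    abs_le_of_sq_le_sq' (by nlinarith [hP x, sq_nonneg ‖(star J) x‖]) (norm_nonneg x) |>.2
  have hB1 : ∀ x, ‖(star J) x‖ ≤ ‖x‖ := fun x =>
    abs_le_of_sq_le_sq' (by nlinarith [hP x, sq_nonneg ‖(1 - J * star J) x‖]) (norm_nonneg x) |>.2
  refine ContinuousLinearMap.opNorm_le_bound _ (by positivity) fun x => ?_
  have h1 : ‖A x + (c : ℂ) • J ((star J) ((star J) x))‖ ≤ c * ‖x‖ := by
    have horth : inner ℂ (A x) ((c : ℂ) • J ((star J) ((star J) x))) = 0 := by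
      rw [inner_smul_right, ← ContinuousLinearMap.adjoint_inner_left,
        ← ContinuousLinearMap.star_eq_adjoint, ← mul_apply_eq_comp (star J), hBA]
      simp
    have h := norm_add_sq_eq_norm_sq_add_norm_sq_of_inner_eq_zero _ _ horth
    have hA : ‖A x‖ ≤ c * ‖(1 - J * star J) x‖ := by
      have : A x = A ((1 - J * star J) x) := by
        rw [← mul_apply_eq_comp, mul_sub, ← mul_assoc, hAJ]
        simp
      rw [this]
      exact A.le_of_opNorm_le hAc _
    have hC : ‖(c : ℂ) • J ((star J) ((star J) x))‖ ≤ c * ‖(star J) x‖ := by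
      rw [norm_smul, hiso, Complex.norm_real, Real.norm_of_nonneg hc]
      gcongr
      exact hB1 _
    refine abs_le_of_sq_le_sq' ?_ (by positivity) |>.2
    rw [pow_two, h, ← pow_two, ← pow_two, mul_pow, ← hP x, mul_add, ← mul_pow, ← mul_pow]
    gcongr
  have h2 : ‖(e : ℂ) • (1 - J * star J) ((star J) x)‖ ≤ e * ‖x‖ := by
    rw [norm_smul, Complex.norm_real, Real.norm_of_nonneg he]
    gcongr
    exact (hP1 _).trans (hB1 _)
  have h3 : perturbedShift J (star J) A e c x = (A x + (c : ℂ) • J ((star J) ((star J) x))) +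
      (e : ℂ) • (1 - J * star J) ((star J) x) := by
    simp only [perturbedShift, add_apply, smul_apply,
      mul_apply_eq_comp]
    abel
  rw [h3]
  exact (norm_add_le _ _).trans (by linarith)

end Shift

section Approximation

variable {H : Type*} [NormedAddCommGroup H] [InnerProductSpace ℂ H] [CompleteSpace H]

/-! ### A pure isometry on an infinite-dimensional space -/

/-- An infinite-dimensional Hilbert space carries a shift: an isometry `V` whose adjoint is locally
nilpotent on a dense set. -/
theorem exists_isometry_adjoint_nilpotent (hH : ¬ FiniteDimensional ℂ H) :
    ∃ V : H →L[ℂ] H, star V * V = 1 ∧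
      Dense {x : H | ∀ᶠ n : ℕ in atTop, (star V ^ n) x = 0} := by
  classical
  obtain ⟨w, b, -⟩ := exists_hilbertBasis (𝕜 := ℂ) (E := H)
  have : Infinite w := by
    by_contra hfin
    have : Finite w := not_infinite_iff_finite.1 hfin
    have := Fintype.ofFinite w
    exact hH b.toOrthonormalBasis.toBasis.finiteDimensional_of_finite
  -- The basis is arranged in sequences, and `V` shifts each of them.
  obtain ⟨e⟩ : Nonempty (w ≃ w × ℕ) := by
    rw [← Cardinal.eq, Cardinal.mk_prod, Cardinal.mk_nat, Cardinal.lift_aleph0, Cardinal.lift_uzero,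
      Cardinal.mul_aleph0_eq (Cardinal.aleph0_le_mk w)]
  let s : w → w := fun j => e.symm ((e j).1, (e j).2 + 1)
  have hs : Function.Injective s := by
    intro i j hij
    have h := e.symm.injective hij
    simp only [Prod.mk.injEq, add_left_inj] at h
    exact e.injective (Prod.ext h.1 h.2)
  have hv : Orthonormal ℂ (fun j => b (s j)) := b.orthonormal.comp s hs
  let V₀ : H →ₗᵢ[ℂ] H := hv.orthogonalFamily.linearIsometry.comp b.repr.toLinearIsometry
  let V : H →L[ℂ] H := V₀.toContinuousLinearMap
  have hVb : ∀ j, V (b j) = b (s j) := fun j => by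
    change hv.orthogonalFamily.linearIsometry (b.repr (b j)) = b (s j)
    rw [b.repr_self, OrthogonalFamily.linearIsometry_apply_single]
    simp
  have hVV : star V * V = 1 :=
    (ContinuousLinearMap.norm_map_iff_adjoint_comp_self V).1 V₀.norm_map
  have hsucc : ∀ j, star V (b (s j)) = b j := fun j => by
    rw [← hVb, ← mul_apply_eq_comp, hVV, one_apply_eq_self]
  have hdense : Dense (Submodule.span ℂ (Set.range b) : Set H) :=
    Submodule.dense_iff_topologicalClosure_eq_top.2 b.dense_span
  have hzero : ∀ i, star V (b (e.symm (i, 0))) = 0 := fun i => by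
    refine hdense.eq_zero_of_inner_right ℂ fun v hv => ?_
    induction hv using Submodule.span_induction with
    | mem v hv =>
      obtain ⟨j, rfl⟩ := hv
      have hne : s j ≠ e.symm (i, 0) := fun h => by
        simpa using congrArg Prod.snd (e.symm.injective h)
      rw [ContinuousLinearMap.star_eq_adjoint, ContinuousLinearMap.adjoint_inner_right, hVb]
      exact b.orthonormal.2 hne
    | zero => exact inner_zero_left _
    | add v w _ _ hv hw => rw [inner_add_left, hv, hw, add_zero]
    | smul a v _ hv => rw [inner_smul_left, hv, mul_zero]
  refine ⟨V, hVV, ?_⟩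
  have hnil : ∀ n i, (star V ^ (n + 1)) (b (e.symm (i, n))) = 0 := by
    intro n i
    induction n with
    | zero => simpa using hzero i
    | succ n ih =>
      have : e.symm (i, n + 1) = s (e.symm (i, n)) := by simp [s]
      rw [pow_succ, mul_apply_eq_comp, this, hsucc, ih]
  have hmono : ∀ {m n : ℕ} {x : H}, (star V ^ m) x = 0 → m ≤ n → (star V ^ n) x = 0 := by
    intro m n x hx hmn
    obtain ⟨k, rfl⟩ := Nat.exists_eq_add_of_le' hmn
    rw [pow_add, mul_apply_eq_comp, hx, map_zero]
  refine hdense.mono fun x hx => ?_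
  induction hx using Submodule.span_induction with
  | mem x hx =>
    obtain ⟨j, rfl⟩ := hx
    filter_upwards [eventually_ge_atTop ((e j).2 + 1)] with n hn
    refine hmono ?_ hn
    simpa using hnil (e j).2 (e j).1
  | zero => simp
  | add x y _ _ hx hy =>
    filter_upwards [hx, hy] with n h1 h2
    rw [map_add, h1, h2, add_zero]
  | smul a x _ hx =>
    filter_upwards [hx] with n h1
    rw [map_smul, h1, smul_zero]

variable {V : H →L[ℂ] H}

/-! ### Approximation of a bounded operator by perturbed shifts -/

theorem norm_le_one_of_star_mul_self (hV : star V * V = 1) : ‖V‖ ≤ 1 := by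
  refine V.opNorm_le_bound zero_le_one fun x => ?_
  rw [(ContinuousLinearMap.norm_map_iff_adjoint_comp_self V).2 hV, one_mul]

theorem tendsto_star_pow_apply (hV : star V * V = 1)
    (hd : Dense {x : H | ∀ᶠ n : ℕ in atTop, (star V ^ n) x = 0}) (x : H) :
    Tendsto (fun n : ℕ => (star V ^ n) x) atTop (𝓝 0) := by
  have hnorm : ∀ (n : ℕ) (y : H), ‖(star V ^ n) y‖ ≤ ‖y‖ := fun n y => by
    have h := norm_le_one_of_star_mul_self (pow_mul_pow_eq_one hV n ▸ by rw [star_pow] :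
      star (V ^ n) * V ^ n = 1)
    rw [← norm_star, star_pow] at h
    simpa using (star V ^ n).le_of_opNorm_le h y
  refine Metric.tendsto_atTop.2 fun ε hε => ?_
  obtain ⟨y, hyx, hy⟩ := Metric.dense_iff.1 hd x ε hε
  obtain ⟨m, hm⟩ := eventually_atTop.1 hy
  refine ⟨m, fun n hn => ?_⟩
  rw [dist_zero_right, ← sub_zero ((star V ^ n) x), ← hm n hn, ← map_sub]
  exact (hnorm n _).trans_lt (by rw [← dist_eq_norm, dist_comm]; exact hyx)

/-- For an isometry `V`, the orthogonal projection `1 - V ^ n V⋆ ^ n` onto `ker (V⋆ ^ n)`, which is the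
first block of the shift `V ^ n`. -/
def blockProj (V : H →L[ℂ] H) (n : ℕ) : H →L[ℂ] H := 1 - V ^ n * star (V ^ n)

theorem star_blockProj (n : ℕ) : star (blockProj V n) = blockProj V n := by
  simp [blockProj]

theorem star_pow_mul_pow (hV : star V * V = 1) (n : ℕ) : star (V ^ n) * V ^ n = 1 := by
  rw [star_pow, pow_mul_pow_eq_one hV]

theorem blockProj_mul_pow (hV : star V * V = 1) (n : ℕ) : blockProj V n * V ^ n = 0 := by
  rw [blockProj, sub_mul, mul_assoc, star_pow_mul_pow hV, one_mul, mul_one, sub_self]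

theorem star_pow_mul_blockProj (hV : star V * V = 1) (n : ℕ) :
    star (V ^ n) * blockProj V n = 0 := by
  rw [blockProj, mul_sub, ← mul_assoc, star_pow_mul_pow hV, one_mul, mul_one, sub_self]

theorem norm_blockProj_le (hV : star V * V = 1) (n : ℕ) : ‖blockProj V n‖ ≤ 1 := by
  refine ContinuousLinearMap.opNorm_le_bound _ zero_le_one fun x => ?_
  have h := norm_sq_add_norm_sq_star (star_pow_mul_pow hV n) x
  rw [one_mul]
  exact (abs_le_of_sq_le_sq' (by
    rw [blockProj]; nlinarith [sq_nonneg ‖(star (V ^ n)) x‖]) (norm_nonneg x)).2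

omit [CompleteSpace H] in
theorem tendsto_apply_of_norm_le {L : ℕ → H →L[ℂ] H} {C : ℝ} (hL : ∀ n, ‖L n‖ ≤ C) {u : ℕ → H}
    {a y : H} (hu : Tendsto u atTop (𝓝 a)) (ha : Tendsto (fun n => L n a) atTop (𝓝 y)) :
    Tendsto (fun n => L n (u n)) atTop (𝓝 y) := by
  have h : Tendsto (fun n => L n (u n - a)) atTop (𝓝 0) := by
    refine squeeze_zero_norm (fun n => (L n).le_of_opNorm_le (hL n) _) ?_
    have := (tendsto_iff_norm_sub_tendsto_zero.1 hu).const_mul C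
    simpa using this
  simpa using h.add ha

/-- The approximants of `T`. With `d = (M - 1) / (n + 2)`, the perturbing operator is the compression of
`T` to `ker (V⋆ ^ n)`, scaled to have norm at most `M - 2 d`, and the block shift `V⋆ ^ n` carries the
weight `d` on the first block and `M - d` on the others. So the norm stays at most `M`, while
`M - d` exceeds both `1` and the norm of the perturbing operator. -/
def shiftApprox (V T : H →L[ℂ] H) (M : ℝ) (n : ℕ) : H →L[ℂ] H :=
  perturbedShift (V ^ n) (star (V ^ n))
    (((1 - 2 * ((M - 1) / (n + 2)) / M : ℝ) : ℂ) • (blockProj V n * T * blockProj V n))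
    (((M - 1) / (n + 2) : ℝ) : ℂ) ((M - (M - 1) / (n + 2) : ℝ) : ℂ)

variable {T : H →L[ℂ] H} {M : ℝ}

theorem norm_smul_compression_le (hV : star V * V = 1) (hT : ‖T‖ ≤ M) (hM : 1 < M) (n : ℕ) :
    ‖((1 - 2 * ((M - 1) / (n + 2)) / M : ℝ) : ℂ) • (blockProj V n * T * blockProj V n)‖ ≤
      M - 2 * ((M - 1) / (n + 2)) := by
  have h1 : (M - 1) / ((n : ℝ) + 2) ≤ (M - 1) / 2 :=
    div_le_div_of_nonneg_left (by linarith) (by norm_num) (by linarith [n.cast_nonneg (α := ℝ)])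
  have h2 : 0 ≤ 1 - 2 * ((M - 1) / ((n : ℝ) + 2)) / M := by
    rw [sub_nonneg, div_le_one (by linarith)]
    linarith
  have h3 : ‖blockProj V n * T * blockProj V n‖ ≤ M := by
    have hP := norm_blockProj_le hV n
    calc _ ≤ ‖blockProj V n‖ * ‖T‖ * ‖blockProj V n‖ := norm_mul₃_le
      _ ≤ 1 * M * 1 := by gcongr
      _ = M := by ring
  rw [norm_smul, Complex.norm_real, Real.norm_of_nonneg h2]
  calc _ ≤ (1 - 2 * ((M - 1) / ((n : ℝ) + 2)) / M) * M := by gcongr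
    _ = _ := by field_simp

theorem norm_shiftApprox_le (hV : star V * V = 1) (hT : ‖T‖ ≤ M) (hM : 1 < M) (n : ℕ) :
    ‖shiftApprox V T M n‖ ≤ M := by
  have h1 : 0 < (M - 1) / ((n : ℝ) + 2) := div_pos (by linarith) (by positivity)
  refine (norm_perturbedShift_le (star_pow_mul_pow hV n) ?_ ?_
    ((norm_smul_compression_le hV hT hM n).trans ?_) h1.le).trans ?_
  · rw [smul_mul_assoc, mul_assoc _ _ (V ^ n), blockProj_mul_pow hV, mul_zero, smul_zero]
  · rw [mul_smul_comm, mul_assoc, ← mul_assoc, star_pow_mul_blockProj hV, zero_mul, smul_zero]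
  · linarith
  · linarith

theorem isExpandingShift_shiftApprox (hV : star V * V = 1)
    (hd : Dense {x : H | ∀ᶠ n : ℕ in atTop, (star V ^ n) x = 0}) (hne : ∃ x : H, x ≠ 0)
    (hT : ‖T‖ ≤ M) (hM : 1 < M) {n : ℕ} (hn : n ≠ 0) : IsExpandingShift (shiftApprox V T M n) := by
  have h1 : 0 < (M - 1) / ((n : ℝ) + 2) := div_pos (by linarith) (by positivity)
  have h2 : (M - 1) / ((n : ℝ) + 2) < M - 1 :=
    div_lt_self (by linarith) (by linarith [n.cast_nonneg (α := ℝ)])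
  have hdn : Dense {x : H | ∀ᶠ k : ℕ in atTop, (star (V ^ n) ^ k) x = 0} := by
    refine hd.mono fun x hx => ?_
    have := (tendsto_id.const_mul_atTop' (Nat.pos_of_ne_zero hn)).eventually hx
    simpa [star_pow, ← pow_mul] using this
  -- `ker (V⋆ ^ n)` is nonzero: under an injective operator no orbit of a nonzero vector vanishes.
  obtain ⟨u, hu, hBu⟩ : ∃ u : H, u ≠ 0 ∧ (star (V ^ n)) u = 0 := by
    by_contra! hinj
    obtain ⟨x, hx⟩ := hne
    obtain ⟨y, hy0, hy⟩ := hdn.inter_open_nonempty {0}ᶜ isOpen_compl_singleton ⟨x, hx⟩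
    obtain ⟨m, hm⟩ := hy.exists
    refine absurd hm ?_
    have : ∀ k : ℕ, (star (V ^ n) ^ k) y ≠ 0 := fun k => by
      induction k with
      | zero => simpa using hy0
      | succ k ih =>
        rw [pow_succ', mul_apply_eq_comp]
        exact fun h => hinj _ ih h
    exact this m
  refine isExpandingShift_perturbedShift (star_pow_mul_pow hV n)
    (norm_le_one_of_star_mul_self (star_pow_mul_pow hV n)) ?_ ?_ ?_ ?_
    ((norm_smul_compression_le hV hT hM n).trans_lt ?_) hdn hu hBu
  · rw [smul_mul_assoc, mul_assoc _ _ (V ^ n), blockProj_mul_pow hV, mul_zero, smul_zero]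
  · rw [mul_smul_comm, mul_assoc, ← mul_assoc, star_pow_mul_blockProj hV, zero_mul, smul_zero]
  · exact_mod_cast h1.ne'
  · linarith
  · linarith

theorem tendsto_blockProj_apply (hV : star V * V = 1)
    (hd : Dense {x : H | ∀ᶠ n : ℕ in atTop, (star V ^ n) x = 0}) (x : H) :
    Tendsto (fun n => blockProj V n x) atTop (𝓝 x) := by
  have h : Tendsto (fun n : ℕ => (V ^ n) ((star (V ^ n)) x)) atTop (𝓝 0) := by
    refine squeeze_zero_norm (fun n => ?_) (tendsto_zero_iff_norm_tendsto_zero.1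
      (tendsto_star_pow_apply hV hd x))
    rw [(ContinuousLinearMap.norm_map_iff_adjoint_comp_self (V ^ n)).2 (star_pow_mul_pow hV n),
      star_pow]
  simpa [blockProj] using h.const_sub x

theorem tendsto_compression_apply (hV : star V * V = 1)
    (hd : Dense {x : H | ∀ᶠ n : ℕ in atTop, (star V ^ n) x = 0}) (T : H →L[ℂ] H) (x : H) :
    Tendsto (fun n => (blockProj V n * T * blockProj V n) x) atTop (𝓝 (T x)) :=
  tendsto_apply_of_norm_le (norm_blockProj_le hV)
    ((T.continuous.tendsto x).comp (tendsto_blockProj_apply hV hd x))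
    (tendsto_blockProj_apply hV hd (T x))

theorem tendsto_weight (M : ℝ) : Tendsto (fun n : ℕ => (M - 1) / ((n : ℝ) + 2)) atTop (𝓝 0) :=
  tendsto_const_nhds.div_atTop (tendsto_atTop_add_const_right _ _ tendsto_natCast_atTop_atTop)

omit [CompleteSpace H] in
/-- The common shape of the approximants and of their adjoints: the terms carrying the small weight
only need to be bounded, those carrying the large weight have to tend to zero by themselves. -/
theorem tendsto_shiftApprox_aux {A : ℕ → H →L[ℂ] H} {f g : ℕ → H} {x y : H}
    (hA : Tendsto (fun n => A n x) atTop (𝓝 y)) {C : ℝ} (hf : ∀ n, ‖f n‖ ≤ C)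
    (hg : Tendsto g atTop (𝓝 0)) :
    Tendsto (fun n : ℕ => ((1 - 2 * ((M - 1) / (n + 2)) / M : ℝ) : ℂ) • A n x +
      (((M - 1) / (n + 2) : ℝ) : ℂ) • f n + ((M - (M - 1) / (n + 2) : ℝ) : ℂ) • g n) atTop
      (𝓝 y) := by
  have hw := tendsto_weight M
  have h1 : Tendsto (fun n : ℕ => ((1 - 2 * ((M - 1) / (n + 2)) / M : ℝ) : ℂ)) atTop (𝓝 1) := by
    have := (Complex.continuous_ofReal.tendsto _).comp (((hw.const_mul 2).div_const M).const_sub 1)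
    simpa [Function.comp_def] using this
  have h2 : Tendsto (fun n : ℕ => ((M - (M - 1) / (n + 2) : ℝ) : ℂ)) atTop (𝓝 M) := by
    have := (Complex.continuous_ofReal.tendsto _).comp (hw.const_sub M)
    simpa [Function.comp_def] using this
  have h3 : Tendsto (fun n : ℕ => (((M - 1) / (n + 2) : ℝ) : ℂ) • f n) atTop (𝓝 0) := by
    refine squeeze_zero_norm (a := fun n : ℕ => |(M - 1) / ((n : ℝ) + 2)| * C) (fun n => ?_) ?_
    · rw [norm_smul, Complex.norm_real, Real.norm_eq_abs]
      gcongr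
      exact hf n
    · simpa using hw.abs.mul_const C
  simpa using ((h1.smul hA).add h3).add (h2.smul hg)

theorem tendsto_shiftApprox_apply (hV : star V * V = 1)
    (hd : Dense {x : H | ∀ᶠ n : ℕ in atTop, (star V ^ n) x = 0}) (T : H →L[ℂ] H) (M : ℝ) (x : H) :
    Tendsto (fun n => shiftApprox V T M n x) atTop (𝓝 (T x)) := by
  have hJ := fun n => norm_le_one_of_star_mul_self (star_pow_mul_pow hV n)
  have hB : ∀ n, ‖star (V ^ n)‖ ≤ 1 := fun n => by rw [norm_star]; exact hJ n
  have hB0 : Tendsto (fun n => (star (V ^ n)) x) atTop (𝓝 0) := by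
    simpa only [star_pow] using tendsto_star_pow_apply hV hd x
  refine tendsto_shiftApprox_aux (C := ‖x‖)
    (f := fun n => (blockProj V n * star (V ^ n)) x)
    (g := fun n => (V ^ n * star (V ^ n) * star (V ^ n)) x) (tendsto_compression_apply hV hd T x)
    (fun n => ?_) ?_
  · refine (ContinuousLinearMap.le_of_opNorm_le _ ((norm_mul_le _ _).trans (mul_le_one₀
      (norm_blockProj_le hV n) (norm_nonneg _) (hB n))) x).trans (by rw [one_mul])
  · exact tendsto_apply_of_norm_le (L := fun n => V ^ n * star (V ^ n)) (fun n =>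
      (norm_mul_le _ _).trans (mul_le_one₀ (hJ n) (norm_nonneg _) (hB n))) hB0 (by simp)

theorem tendsto_star_shiftApprox_apply (hV : star V * V = 1)
    (hd : Dense {x : H | ∀ᶠ n : ℕ in atTop, (star V ^ n) x = 0}) (T : H →L[ℂ] H) (M : ℝ) (x : H) :
    Tendsto (fun n => star (shiftApprox V T M n) x) atTop (𝓝 (star T x)) := by
  have hJ := fun n => norm_le_one_of_star_mul_self (star_pow_mul_pow hV n)
  have hB0 : Tendsto (fun n => (star (V ^ n)) x) atTop (𝓝 0) := by
    simpa only [star_pow] using tendsto_star_pow_apply hV hd x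
  have h := tendsto_shiftApprox_aux (M := M) (C := ‖x‖)
    (f := fun n => (V ^ n * blockProj V n) x)
    (g := fun n => (V ^ n * V ^ n * star (V ^ n)) x)
    (tendsto_compression_apply hV hd (star T) x) (fun n => ?_) ?_
  · refine h.congr fun n => ?_
    have hst : ∀ (r : ℝ) (L : H →L[ℂ] H), star ((r : ℂ) • L) = (r : ℂ) • star L := fun r L => by
      rw [star_smul]; simp
    have hP : 1 - V ^ n * star (V ^ n) = blockProj V n := rfl
    simp only [shiftApprox, perturbedShift, star_add, hst, star_mul, star_star, star_blockProj, hP,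
      add_apply, smul_apply, mul_assoc]
  · refine (ContinuousLinearMap.le_of_opNorm_le _ ((norm_mul_le _ _).trans (mul_le_one₀
      (hJ n) (norm_nonneg _) (norm_blockProj_le hV n))) x).trans (by rw [one_mul])
  · exact tendsto_apply_of_norm_le (L := fun n => V ^ n * V ^ n) (fun n =>
      (norm_mul_le _ _).trans (mul_le_one₀ (hJ n) (norm_nonneg _) (hJ n))) hB0 (by simp)

/-! ### Typical operators -/

theorem OperatorBall.tendsto_iff {ι : Type*} {l : Filter ι} {f : ι → OperatorBall H M}
    {T : OperatorBall H M} : Tendsto f l (𝓝 T) ↔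
      (∀ x, Tendsto (fun i => (f i).op x) l (𝓝 (T.op x))) ∧
      ∀ x, Tendsto (fun i => star (f i).op x) l (𝓝 (star T.op x)) := by
  rw [nhds_induced, tendsto_comap_iff, nhds_prod_eq, tendsto_prod_iff', tendsto_pi_nhds,
    tendsto_pi_nhds]
  rfl

theorem OperatorBall.continuous_op_apply :
    Continuous fun p : OperatorBall H M × H => p.1.op p.2 := by
  refine continuous_iff_continuousAt.2 fun p => ?_
  have h1 : Tendsto (fun q : OperatorBall H M × H => q.1.op p.2) (𝓝 p) (𝓝 (p.1.op p.2)) :=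
    (OperatorBall.tendsto_iff.1 (continuous_fst.tendsto p)).1 p.2
  have h2 : Tendsto (fun q : OperatorBall H M × H => q.1.op (q.2 - p.2)) (𝓝 p) (𝓝 0) := by
    refine squeeze_zero_norm (fun q => q.1.op.le_of_opNorm_le q.1.2 _) ?_
    have h3 : Continuous fun q : OperatorBall H M × H => M * ‖q.2 - p.2‖ := by fun_prop
    simpa using h3.tendsto p
  have h := h1.add h2
  simpa [ContinuousAt] using h

theorem OperatorBall.continuous_op_pow_apply (n : ℕ) :
    Continuous fun p : OperatorBall H M × H => (p.1.op ^ n) p.2 := by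
  induction n with
  | zero => simpa using continuous_snd
  | succ n ih =>
    simp only [pow_succ', mul_apply_eq_comp]
    exact OperatorBall.continuous_op_apply.comp (continuous_fst.prodMk ih)

/-- Every operator of the ball is the limit of an explicit sequence of perturbed backward shifts. -/
theorem dense_isExpandingShift (hH : ¬ FiniteDimensional ℂ H) (hM : 1 < M) :
    Dense {T : OperatorBall H M | IsExpandingShift T.op} := by
  obtain ⟨V, hV, hd⟩ := exists_isometry_adjoint_nilpotent hH
  have hne : ∃ x : H, x ≠ 0 := by
    by_contra! h
    have : Subsingleton H := ⟨fun x y => by rw [h x, h y]⟩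
    exact hH inferInstance
  intro T
  let f : ℕ → OperatorBall H M := fun n =>
    ⟨shiftApprox V T.op M n, norm_shiftApprox_le hV T.2 hM n⟩
  have hf : Tendsto f atTop (𝓝 T) := OperatorBall.tendsto_iff.2
    ⟨tendsto_shiftApprox_apply hV hd T.op M, tendsto_star_shiftApprox_apply hV hd T.op M⟩
  exact mem_closure_of_tendsto hf ((eventually_ne_atTop 0).mono fun n hn =>
    isExpandingShift_shiftApprox hV hd hne T.2 hM hn)

/-- The pairs `(T, x)` for which, up to the precision `1 / (k + 1)` and at some time beyond `N`, the
orbit of `x` spends almost all of its time near the origin. -/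
def nearPairs (H : Type*) [NormedAddCommGroup H] [InnerProductSpace ℂ H] (M : ℝ) (k N : ℕ) :
    Set (OperatorBall H M × H) :=
  {p | FillsInterval {i | ‖(p.1.op ^ i) p.2‖ < 1 / ((k : ℝ) + 1)} (1 / ((k : ℝ) + 1)) N}

/-- The pairs `(T, x)` for which, up to the precision `1 / (k + 1)` and at some time beyond `N`, the
orbit of `x` spends almost all of its time outside the ball of radius `k`. -/
def farPairs (H : Type*) [NormedAddCommGroup H] [InnerProductSpace ℂ H] (M : ℝ) (k N : ℕ) :
    Set (OperatorBall H M × H) :=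
  {p | FillsInterval {i | (k : ℝ) < ‖(p.1.op ^ i) p.2‖} (1 / ((k : ℝ) + 1)) N}

/-- The pairs `(T, x)` for which the orbit of `x` under `T` meets `W`. -/
def visitPairs (M : ℝ) (W : Set H) : Set (OperatorBall H M × H) :=
  {p | ∃ n : ℕ, (p.1.op ^ n) p.2 ∈ W}

theorem isOpen_nearPairs (k N : ℕ) : IsOpen (nearPairs H M k N) :=
  isOpen_setOf_fillsInterval (fun i =>
    isOpen_lt (OperatorBall.continuous_op_pow_apply i).norm continuous_const) _ _

theorem isOpen_farPairs (k N : ℕ) : IsOpen (farPairs H M k N) :=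
  isOpen_setOf_fillsInterval (fun i =>
    isOpen_lt continuous_const (OperatorBall.continuous_op_pow_apply i).norm) _ _

theorem isOpen_visitPairs {W : Set H} (hW : IsOpen W) : IsOpen (visitPairs M W) := by
  have : visitPairs M W =
      ⋃ n : ℕ, (fun p : OperatorBall H M × H => (p.1.op ^ n) p.2) ⁻¹' W := by
    ext p
    simp [visitPairs]
  rw [this]
  exact isOpen_iUnion fun n => hW.preimage (OperatorBall.continuous_op_pow_apply n)

theorem isDenselyDistributionallyChaotic_iff {T : OperatorBall H M} :
    IsDenselyDistributionallyChaotic T.op ↔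
      ∀ q : ℕ × ℕ, Dense {x | (T, x) ∈ nearPairs H M q.1 q.2 ∩ farPairs H M q.1 q.2} := by
  constructor
  · intro h q
    refine h.mono fun x hx => ?_
    have hx' := isDistributionallyIrregular_iff.1 hx
    exact ⟨hx'.1 _ _, hx'.2 _ _⟩
  · intro h
    refine (dense_setOf_forall_mem_fibre
      (fun q : ℕ × ℕ => (isOpen_nearPairs q.1 q.2).inter (isOpen_farPairs q.1 q.2)) h).mono ?_
    exact fun x hx => isDistributionallyIrregular_iff.2
      ⟨fun k N => (hx (k, N)).1, fun k N => (hx (k, N)).2⟩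

theorem isOpen_visitPairs_inter_nearPairs [SecondCountableTopology H]
    (q : TopologicalSpace.countableBasis H × ℕ × ℕ) :
    IsOpen (visitPairs M (q.1 : Set H) ∩ nearPairs H M q.2.1 q.2.2) :=
  (isOpen_visitPairs (TopologicalSpace.isOpen_of_mem_countableBasis q.1.2)).inter
    (isOpen_nearPairs _ _)

/-- By Baire's theorem in `H`, a generic vector is hypercyclic and its orbit is near the origin with
upper density one. -/
theorem isHypercyclic_and_cParam_eq_one [SecondCountableTopology H] {T : OperatorBall H M}
    (hT : ∀ q : TopologicalSpace.countableBasis H × ℕ × ℕ,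
      Dense {x | (T, x) ∈ visitPairs M (q.1 : Set H) ∩ nearPairs H M q.2.1 q.2.2}) :
    IsHypercyclic T.op ∧ cParam T.op = 1 := by
  obtain ⟨x, hx⟩ :=
    (dense_setOf_forall_mem_fibre isOpen_visitPairs_inter_nearPairs hT).nonempty
  have hHC : x ∈ hypercyclicVectors T.op := by
    refine (TopologicalSpace.isBasis_countableBasis H).dense_iff.2 fun W hW hne => ?_
    obtain ⟨n, hn⟩ := (hx (⟨W, hW⟩, 0, 0)).1
    exact ⟨_, hn, n, rfl⟩
  obtain ⟨W, hW, -⟩ :=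
    (TopologicalSpace.isBasis_countableBasis H).exists_subset_of_mem_open (Set.mem_univ (0 : H))
      isOpen_univ
  exact ⟨⟨x, hHC⟩, cParam_eq_one hHC fun k N => (hx (⟨W, hW⟩, k, N)).2⟩

theorem preimage_val_mem_residual {X : Type*} [TopologicalSpace X] {s t : Set X} (hs : Dense s)
    (ht : t ∈ residual X) : ((↑) : s → X) ⁻¹' t ∈ residual s := by
  obtain ⟨S, hSo, hSd, hSc, hSt⟩ := mem_residual_iff.1 ht
  refine mem_of_superset ((countable_bInter_mem hSc).2 fun u hu => ?_)
    (show ⋂ u ∈ S, ((↑) : s → X) ⁻¹' u ⊆ _ from ?_)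
  · refine residual_of_dense_open ((hSo u hu).preimage continuous_subtype_val) ?_
    rw [Subtype.dense_iff]
    intro x hx
    rw [Subtype.image_preimage_coe]
    exact (hs.inter_of_isOpen_right (hSd u hu) (hSo u hu)) x
  · intro x hx
    exact hSt (Set.mem_sInter.2 fun u hu => Set.mem_iInter₂.1 hx u hu)

theorem isGδ_isDenselyDistributionallyChaotic [TopologicalSpace.SeparableSpace H] :
    IsGδ {T : OperatorBall H M | IsDenselyDistributionallyChaotic T.op} := by
  have : SecondCountableTopology H := UniformSpace.secondCountable_of_separable H
  simp only [isDenselyDistributionallyChaotic_iff]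
  exact isGδ_setOf_forall_dense_fibre fun q : ℕ × ℕ =>
    (isOpen_nearPairs q.1 q.2).inter (isOpen_farPairs q.1 q.2)

theorem dense_isDenselyDistributionallyChaotic (hH : ¬ FiniteDimensional ℂ H) (hM : 1 < M) :
    Dense {T : OperatorBall H M | IsDenselyDistributionallyChaotic T.op} := by
  refine (dense_isExpandingShift hH hM).mono fun T hT =>
    isDenselyDistributionallyChaotic_iff.2 fun q => ?_
  exact (hT.dense_near q.1 q.2).inter_of_isOpen_left (hT.dense_far q.1 q.2)
    ((isOpen_nearPairs q.1 q.2).preimage (Continuous.prodMk_right T))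

theorem IsExpandingShift.dense_visitPairs_inter_nearPairs [SecondCountableTopology H]
    {T : OperatorBall H M} (hT : IsExpandingShift T.op)
    (q : TopologicalSpace.countableBasis H × ℕ × ℕ) :
    Dense {x | (T, x) ∈ visitPairs M (q.1 : Set H) ∩ nearPairs H M q.2.1 q.2.2} := by
  have hq := TopologicalSpace.isOpen_of_mem_countableBasis q.1.2
  exact (hT.dense_visit hq
    (TopologicalSpace.nonempty_of_mem_countableBasis q.1.2)).inter_of_isOpen_left
    (hT.dense_near q.2.1 q.2.2) ((isOpen_visitPairs hq).preimage (Continuous.prodMk_right T))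

theorem isHypercyclic_and_cParam_eq_one_mem_residual [TopologicalSpace.SeparableSpace H]
    (hH : ¬ FiniteDimensional ℂ H) (hM : 1 < M) :
    {T : OperatorBall H M | IsHypercyclic T.op ∧ cParam T.op = 1} ∈
      residual (OperatorBall H M) := by
  have : SecondCountableTopology H := UniformSpace.secondCountable_of_separable H
  exact mem_of_superset (residual_of_dense_Gδ
    (isGδ_setOf_forall_dense_fibre isOpen_visitPairs_inter_nearPairs)
    ((dense_isExpandingShift hH hM).mono fun T hT => hT.dense_visitPairs_inter_nearPairs))
    fun T hT => isHypercyclic_and_cParam_eq_one hT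

theorem dense_isHypercyclic [TopologicalSpace.SeparableSpace H]
    (hH : ¬ FiniteDimensional ℂ H) (hM : 1 < M) :
    Dense {T : OperatorBall H M | IsHypercyclic T.op} := by
  have : SecondCountableTopology H := UniformSpace.secondCountable_of_separable H
  exact (dense_isExpandingShift hH hM).mono fun T hT =>
    (isHypercyclic_and_cParam_eq_one hT.dense_visitPairs_inter_nearPairs).1

end Approximation

end

end LinearDynamics

theorem mainTheorem10 {H : Type*} [NormedAddCommGroup H] [InnerProductSpace ℂ H]
    [CompleteSpace H] [TopologicalSpace.SeparableSpace H] (hH : ¬ FiniteDimensional ℂ H)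
    (M : ℝ) (hM : 1 < M) :
    (IsGδ {T : LinearDynamics.OperatorBall H M |
        LinearDynamics.IsDenselyDistributionallyChaotic T.op} ∧
      Dense {T : LinearDynamics.OperatorBall H M |
        LinearDynamics.IsDenselyDistributionallyChaotic T.op}) ∧
    {T : LinearDynamics.OperatorBall H M |
        LinearDynamics.IsDistributionallyChaotic T.op} ∈
      residual (LinearDynamics.OperatorBall H M) ∧
    {T : LinearDynamics.OperatorBall H M |
        LinearDynamics.IsHypercyclic T.op ∧ LinearDynamics.cParam T.op = 1} ∈
      residual (LinearDynamics.OperatorBall H M) ∧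
    {T : {T : LinearDynamics.OperatorBall H M // LinearDynamics.IsHypercyclic T.op} |
        LinearDynamics.cParam T.1.op = 1} ∈
      residual {T : LinearDynamics.OperatorBall H M // LinearDynamics.IsHypercyclic T.op} := by
  have hG := LinearDynamics.isGδ_isDenselyDistributionallyChaotic (H := H) (M := M)
  have hd := LinearDynamics.dense_isDenselyDistributionallyChaotic hH hM
  have hc := LinearDynamics.isHypercyclic_and_cParam_eq_one_mem_residual hH hM
  refine ⟨⟨hG, hd⟩, Filter.mem_of_superset (residual_of_dense_Gδ hG hd) fun T hT => ?_, hc, ?_⟩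
  · have : Nonempty H := ⟨0⟩
    exact Dense.nonempty hT
  · exact Filter.mem_of_superset (LinearDynamics.preimage_val_mem_residual
      (LinearDynamics.dense_isHypercyclic hH hM) hc) fun T hT => hT.2
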